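/- Let $m,N\ge 1$ be integers, let $\theta>0$, and let $x_{n,k},y_{n,k}$ ($1\le n\le N$, $1\le k\le m$) be independent $\mathcal N(0,1/2)$ random variables. For real $\rho_2,\dots,\rho_N$ with $|\rho_n|<1$ put $$g_{1,k}=x_{1,k}+\jmath y_{1,k},\qquad g_{n,k}=\sqrt{1-\rho_n^2}\,x_{n,k}+\rho_n x_{1,k}+\jmath\left(\sqrt{1-\rho_n^2}\,y_{n,k}+\rho_n y_{1,k}\right)\quad(n\ge 2),$$ and $\hat h_n=\sum_{k=1}^m|g_{n,k}|^2$. For $\bar\eta\in\mathbb R$ let $\hat\eta_n=\frac{\bar\eta}{m}\hat h_n$ be the estimated SNR at port $n$, let $\hat\eta=\max_{1\le n\le N}\hat\eta_n$, and let $P_{\rm o}(\theta)=\mathbb P\{\log_2(1+\hat\eta)<\theta\}$ be the outage probability. Then: (i) $\mathbb E[\hat\eta_n]=\bar\eta$ for every $n$, and, as $\bar\eta\to\infty$, $$P_{\rm o}(\theta)\sim\left(\frac{m}{\bar\eta}(2^\theta-1)\right)^{mN}\frac{\Gamma(m+1)^{-N}}{\prod_{n=2}^N(1-\rho_n^2)^m},$$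 that is, the ratio of the two sides tends to $1$. Consequently the diversity order is $\lim_{\bar\eta\to\infty}-\log P_{\rm o}(\theta)/\log\bar\eta=mN$, whatever the $\rho_n$, and the correlation enters only the outage gain $$G_o=\lim_{\bar\eta\to\infty}\bar\eta^{\,mN}P_{\rm o}(\theta)=\frac{(m(2^\theta-1))^{mN}}{\Gamma(m+1)^N\prod_{n=2}^N(1-\rho_n^2)^m}>0.$$ (ii) For every topology, that is, for every wavelength $\lambda>0$ and all displacements $d_2,\dots,d_N>0$ of the ports from the first one, the coefficients $\rho_n=J_0(2\pi d_n/\lambda)$ ($J_0$ the Bessel function of the first kind of order $0$) satisfy $|\rho_n|<1$ for $n\ge2$, so the diversity order is $mN$ and the outage gain is $G_o$. (iii) In particular, for every $W>0$ this holds for the linear topology $d_n=\frac{n-1}{N-1}W\lambda$, the circular topology $d_n=\sin\left(\frac{n-1}{N}\pi\right)W\lambda$ and the wheel-shaped topology $d_n=\frac{W\lambda}{2}$ ($n\ge2$), for all of which $d_n>0$ for $n\ge 2$. -/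

import Mathlib

open MeasureTheory ProbabilityTheory Filter Topology Asymptotics
open scoped NNReal

noncomputable section

namespace FluidAntenna

/-- The Bessel function of the first kind of order zero, by Bessel's integral
`J₀(z) = (1/π) ∫₀^π cos (z sin t) dt`. -/
def besselJ0 (z : ℝ) : ℝ :=
  (1 / Real.pi) * ∫ t in (0 : ℝ)..Real.pi, Real.cos (z * Real.sin t)

/-- The three antenna architectures. -/
inductive Architecture : Type
  | linear
  | circular
  | wheel

/-- Distance of a port from the first port, for an antenna of size `W * lam`. Ports are numbered
from `0`, so the index `n` here is the `(n + 1)`-st port. -/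
def displacement {N : ℕ} (a : Architecture) (W lam : ℝ) (n : Fin N) : ℝ :=
  match a with
  | Architecture.linear => ((n : ℕ) : ℝ) / ((N : ℝ) - 1) * (W * lam)
  | Architecture.circular => Real.sin (((n : ℕ) : ℝ) / (N : ℝ) * Real.pi) * (W * lam)
  | Architecture.wheel => if 0 < (n : ℕ) then W * lam / 2 else 0

/-- Correlation coefficients `J₀(2π dₙ / lam)` for displacements `dₙ` and wavelength `lam`. -/
def spatialCorrelation {N : ℕ} (d : Fin N → ℝ) (lam : ℝ) (n : Fin N) : ℝ :=
  besselJ0 (2 * Real.pi * (d n / lam))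

variable {Ω : Type*} {N m : ℕ} [NeZero N]

/-- The complex Gaussian variables `g n k` (with `σ = 1`); port `0` is the reference port. -/
def gain (ρ : Fin N → ℝ) (x y : Fin N → Fin m → Ω → ℝ) (n : Fin N) (k : Fin m) (ω : Ω) : ℂ :=
  if n = 0 then (x 0 k ω : ℂ) + Complex.I * (y 0 k ω : ℂ)
  else ((Real.sqrt (1 - ρ n ^ 2) * x n k ω + ρ n * x 0 k ω : ℝ) : ℂ)
    + Complex.I * ((Real.sqrt (1 - ρ n ^ 2) * y n k ω + ρ n * y 0 k ω : ℝ) : ℂ)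

/-- The channel power `∑ₖ |g n k|²` at port `n`, the square of a Nakagami-`m` envelope. -/
def channel (ρ : Fin N → ℝ) (x y : Fin N → Fin m → Ω → ℝ) (n : Fin N) (ω : Ω) : ℝ :=
  ∑ k, ‖gain ρ x y n k ω‖ ^ 2

/-- The signal-to-noise ratio at port `n`; `s` is transmit power over noise variance. -/
def portSNR (ρ : Fin N → ℝ) (x y : Fin N → Fin m → Ω → ℝ) (s : ℝ) (n : Fin N) (ω : Ω) : ℝ :=
  s / (m : ℝ) * channel ρ x y n ω

/-- The signal-to-noise ratio of the strongest port. -/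
def selectedSNR (ρ : Fin N → ℝ) (x y : Fin N → Fin m → Ω → ℝ) (s : ℝ) (ω : Ω) : ℝ :=
  Finset.univ.sup' Finset.univ_nonempty (fun n => portSNR ρ x y s n ω)

/-- The probability that `log₂ (1 + SNR)` of the strongest port is below the rate threshold. -/
def outageProbability [MeasurableSpace Ω] (μ : Measure Ω) (ρ : Fin N → ℝ)
    (x y : Fin N → Fin m → Ω → ℝ) (θ s : ℝ) : ℝ :=
  μ.real {ω | Real.logb 2 (1 + selectedSNR ρ x y s ω) < θ}

/-- The outage gain `(m (2^θ - 1))^(mN) / (Γ(m+1)^N ∏_{n ≠ 0} (1 - ρₙ²)^m)`. -/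
def outageGain (m : ℕ) (ρ : Fin N → ℝ) (θ : ℝ) : ℝ :=
  ((m : ℝ) * ((2 : ℝ) ^ θ - 1)) ^ (m * N)
    / (Real.Gamma ((m : ℝ) + 1) ^ N * ∏ n ∈ Finset.univ.erase (0 : Fin N), (1 - ρ n ^ 2) ^ m)

/-- An outage probability, as a function of the average SNR `s`, has diversity order `d` if
`- log (Pout s) / log s → d` as `s → ∞`. -/
def HasDiversityOrder (Pout : ℝ → ℝ) (d : ℝ) : Prop :=
  Tendsto (fun s => - Real.log (Pout s) / Real.log s) atTop (𝓝 d)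

/-- `G` is the outage gain at diversity order `d`: `Pout s` behaves like `G * s ^ (-d)`. -/
def HasOutageGain (Pout : ℝ → ℝ) (d : ℕ) (G : ℝ) : Prop :=
  Tendsto (fun s => Pout s * s ^ d) atTop (𝓝 G)

end FluidAntenna

end

open FluidAntenna

/-!
The real and imaginary parts of all the gains form a vector `M z`, where `z` consists of `2mN`
independent `N(0, 1/2)` variables and `M = T ⊗ 1` for a lower triangular `N × N` matrix `T` with
diagonal `1, √(1 - ρ₂²), …, √(1 - ρ_N²)`. An outage at SNR `s` means that `M z` lies in `r • B`,
where `B` is a product of `N` unit balls of `ℝ^(2m)` and `r² = m (2^θ - 1) / s`. As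
`s → ∞` this set shrinks to the origin, so its probability is asymptotic to the Gaussian density
at `0` times its volume: the power of `r` gives the diversity order `mN`, the correlations enter
only through `det M`, and the powers of `π` from the density and from the balls cancel.

For the topologies, `J₀(z)` is the mean of `cos (z sin t)` over `[0, π]`, and for `z ≠ 0` this
cosine does not have absolute value `1` throughout, so `|J₀(z)| < 1`.
-/

namespace FluidAntenna

open Set Module
open scoped Pointwise Kronecker Matrix

section SmallScale

variable {E : Type*} [NormedAddCommGroup E] [NormedSpace ℝ E] [FiniteDimensional ℝ E]
  [MeasurableSpace E] [BorelSpace E] {μ : Measure E} [μ.IsAddHaarMeasure]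

lemma tendsto_withDensity_real_smul_div_pow {f : E → ℝ} (hf : 0 ≤ f)
    (hfm : AEStronglyMeasurable f μ) (hfc : ContinuousAt f 0) {A : Set E}
    (hA : Bornology.IsBounded A) :
    Tendsto (fun r : ℝ ↦
        (μ.withDensity fun x ↦ ENNReal.ofReal (f x)).real (r • A) / r ^ finrank ℝ E)
      (𝓝[>] 0) (𝓝 (f 0 * μ.real A)) := by
  have hshrink : Tendsto (fun r : ℝ ↦ r • A) (𝓝[>] 0) (𝓝 0).smallSets :=
    ((NormedSpace.isVonNBounded_iff ℝ).2 hA).tendsto_smallSets_nhds.mono_left nhdsWithin_le_nhds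
  have hvol : (fun r : ℝ ↦ μ.real (r • A)) =ᶠ[𝓝[>] 0] fun r ↦ r ^ finrank ℝ E * μ.real A := by
    filter_upwards [self_mem_nhdsWithin] with r hr
    rw [Measure.real, Measure.addHaar_smul_of_nonneg μ hr.le, ENNReal.toReal_mul,
      ENNReal.toReal_ofReal (pow_nonneg hr.le _), Measure.real]
  have hmass (r : ℝ) : (μ.withDensity fun x ↦ ENNReal.ofReal (f x)).real (r • A) =
      ∫ x in r • A, f x ∂μ := by
    rw [Measure.real, withDensity_apply' _ (r • A),
      integral_eq_lintegral_of_nonneg_ae (ae_of_all _ hf) hfm.restrict]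
  have herr := hfc.integral_sub_linear_isLittleO_ae ⟨univ, univ_mem, hfm.restrict⟩ hshrink _ hvol
  have hlim := ((herr.trans_isBigO (isBigO_refl (fun r : ℝ ↦ r ^ finrank ℝ E) _ |>.mul
    (isBigO_const_const (μ.real A) one_ne_zero _))).tendsto_div_nhds_zero).add_const
      (f 0 * μ.real A)
  rw [zero_add] at hlim
  refine hlim.congr' ?_
  filter_upwards [self_mem_nhdsWithin] with r hr
  have hr0 : r ^ finrank ℝ E ≠ 0 := pow_ne_zero _ (ne_of_gt hr)
  rw [hmass, smul_eq_mul]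
  field_simp
  ring

lemma tendsto_withDensity_real_preimage_smul_div_pow {f : E → ℝ} (hf : 0 ≤ f)
    (hfm : AEStronglyMeasurable f μ) (hfc : ContinuousAt f 0) {A : Set E}
    (hA : Bornology.IsBounded A) {L : E →ₗ[ℝ] E} (hL : LinearMap.det L ≠ 0) :
    Tendsto (fun r : ℝ ↦
        (μ.withDensity fun x ↦ ENNReal.ofReal (f x)).real (L ⁻¹' (r • A)) / r ^ finrank ℝ E)
      (𝓝[>] 0) (𝓝 (f 0 * (μ.real A / |LinearMap.det L|))) := by
  have hker : LinearMap.ker L = ⊥ := (L.equivOfDetNeZero hL).ker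
  obtain ⟨C, -, hC⟩ := L.exists_antilipschitzWith hker
  have hvol : μ.real (L ⁻¹' A) = μ.real A / |LinearMap.det L| := by
    rw [Measure.real, Measure.addHaar_preimage_linearMap μ hL, ENNReal.toReal_mul,
      ENNReal.toReal_ofReal (abs_nonneg _), abs_inv, Measure.real, inv_mul_eq_div]
  rw [← hvol]
  refine (tendsto_withDensity_real_smul_div_pow hf hfm hfc (hC.isBounded_preimage hA)).congr' ?_
  filter_upwards [self_mem_nhdsWithin] with r hr
  rw [(isUnit_iff_ne_zero.2 (ne_of_gt hr)).preimage_smul_set L A]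

end SmallScale

section PiMeasure

lemma pi_withDensity_ofReal {ι : Type*} [Fintype ι] {α : ι → Type*} [∀ i, MeasurableSpace (α i)]
    {μ : ∀ i, Measure (α i)} [∀ i, SigmaFinite (μ i)] {f : ∀ i, α i → ℝ} (hf : ∀ i, 0 ≤ f i)
    (hfi : ∀ i, Integrable (f i) (μ i)) :
    Measure.pi (fun i ↦ (μ i).withDensity fun t ↦ ENNReal.ofReal (f i t)) =
      (Measure.pi μ).withDensity fun z ↦ ENNReal.ofReal (∏ i, f i (z i)) := by
  have (i : ι) : IsFiniteMeasure ((μ i).withDensity fun t ↦ ENNReal.ofReal (f i t)) :=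
    isFiniteMeasure_withDensity_ofReal (hfi i).2
  have hprod : 0 ≤ fun z : ∀ i, α i ↦ ∏ i, f i (z i) :=
    fun z ↦ Finset.prod_nonneg fun i _ ↦ hf i (z i)
  refine Measure.pi_eq fun s hs ↦ ?_
  rw [withDensity_apply _ (MeasurableSet.univ_pi hs), Measure.restrict_pi_pi,
    ← ofReal_integral_eq_lintegral_ofReal
      (Integrable.fintype_prod_dep fun i ↦ (hfi i).restrict) (ae_of_all _ hprod),
    integral_fintype_prod_eq_prod,
    ENNReal.ofReal_prod_of_nonneg fun i _ ↦ integral_nonneg (hf i)]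
  refine Finset.prod_congr rfl fun i _ ↦ ?_
  rw [withDensity_apply _ (hs i),
    ofReal_integral_eq_lintegral_ofReal (hfi i).restrict (ae_of_all _ (hf i))]

lemma measurePreserving_curry_symm {ι κ X : Type*} [Fintype ι] [Fintype κ] [MeasurableSpace X]
    (μ : ι → κ → Measure X) [∀ i j, SigmaFinite (μ i j)] :
    MeasurePreserving (MeasurableEquiv.curry ι κ X).symm
      (Measure.pi fun i ↦ Measure.pi (μ i)) (Measure.pi fun p : ι × κ ↦ μ p.1 p.2) := by
  refine ⟨MeasurableEquiv.measurable _, (Measure.pi_eq fun s _ ↦ ?_).symm⟩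
  have hbox : (MeasurableEquiv.curry ι κ X).symm ⁻¹' univ.pi s =
      univ.pi fun i ↦ univ.pi fun j ↦ s (i, j) := by
    ext z
    simp [MeasurableEquiv.curry]
  rw [MeasurableEquiv.map_apply, hbox]
  simp only [Measure.pi_pi, Fintype.prod_prod_type]

lemma memLp_two_dotProduct_pi {ι : Type*} [Fintype ι] {ν : ι → Measure ℝ}
    [∀ i, IsProbabilityMeasure (ν i)] (hν : ∀ i, MemLp id 2 (ν i)) (a : ι → ℝ) :
    MemLp (fun z ↦ a ⬝ᵥ z) 2 (Measure.pi ν) :=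
  memLp_finsetSum _ fun i _ ↦
    ((hν i).comp_measurePreserving (measurePreserving_eval ν i)).const_mul (a i)

lemma integral_dotProduct_sq_pi {ι : Type*} [Fintype ι] {ν : ι → Measure ℝ}
    [∀ i, IsProbabilityMeasure (ν i)] (hν : ∀ i, MemLp id 2 (ν i)) (hmean : ∀ i, (ν i)[id] = 0)
    (a : ι → ℝ) : ∫ z, (a ⬝ᵥ z) ^ 2 ∂Measure.pi ν = ∑ i, a i ^ 2 * Var[id; ν i] := by
  have hcoord (i : ι) : Integrable (fun z : ι → ℝ ↦ a i * z i) (Measure.pi ν) :=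
    (((hν i).comp_measurePreserving (measurePreserving_eval ν i)).integrable one_le_two).const_mul _
  have hzero : ∫ z, a ⬝ᵥ z ∂Measure.pi ν = 0 := by
    simp only [dotProduct]
    rw [integral_finsetSum _ fun i _ ↦ hcoord i]
    refine Finset.sum_eq_zero fun i _ ↦ ?_
    have hi : ∫ z : ι → ℝ, z i ∂Measure.pi ν = 0 := (integral_comp_eval (hν i).1).trans (hmean i)
    rw [integral_const_mul, hi, mul_zero]
  have hvar := variance_sum_pi fun i ↦ (hν i).const_mul (a i)
  rw [show (∑ i, fun z : ι → ℝ ↦ a i * id (z i)) = (a ⬝ᵥ ·) by ext z; simp [dotProduct],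
    variance_of_integral_eq_zero (memLp_two_dotProduct_pi hν a).1.aemeasurable hzero] at hvar
  simpa only [variance_const_mul] using hvar

end PiMeasure

section Gaussian

variable {ι : Type*} [Fintype ι]

lemma integrable_dotProduct_sq_pi_gaussianReal (v : ℝ≥0) (a : ι → ℝ) :
    Integrable (fun z ↦ (a ⬝ᵥ z) ^ 2) (Measure.pi fun _ : ι ↦ gaussianReal 0 v) :=
  (memLp_two_dotProduct_pi (fun _ ↦ memLp_id_gaussianReal' 2 ENNReal.ofNat_ne_top) a).integrable_sq

lemma integral_dotProduct_sq_pi_gaussianReal (v : ℝ≥0) (a : ι → ℝ) :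
    ∫ z, (a ⬝ᵥ z) ^ 2 ∂Measure.pi (fun _ : ι ↦ gaussianReal 0 v) = a ⬝ᵥ a * v := by
  rw [integral_dotProduct_sq_pi (fun _ ↦ memLp_id_gaussianReal' 2 ENNReal.ofNat_ne_top)
    fun _ ↦ integral_id_gaussianReal]
  simp only [variance_id_gaussianReal, dotProduct, Finset.sum_mul, sq]

lemma pi_gaussianReal_eq_withDensity {v : ℝ≥0} (hv : v ≠ 0) :
    Measure.pi (fun _ : ι ↦ gaussianReal 0 v) =
      volume.withDensity fun z ↦ ENNReal.ofReal (∏ i, gaussianPDFReal 0 v (z i)) := by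
  simp only [gaussianReal_of_var_ne_zero _ hv]
  exact pi_withDensity_ofReal (fun _ ↦ gaussianPDFReal_nonneg 0 v)
    fun _ ↦ integrable_gaussianPDFReal 0 v

lemma tendsto_pi_gaussianReal_real_preimage_smul_div_pow [DecidableEq ι] {v : ℝ≥0} (hv : v ≠ 0)
    {A : Set (ι → ℝ)} (hA : Bornology.IsBounded A) {M : Matrix ι ι ℝ} (hM : M.det ≠ 0) :
    Tendsto (fun r : ℝ ↦ (Measure.pi fun _ : ι ↦ gaussianReal 0 v).real
        ((M *ᵥ ·) ⁻¹' (r • A)) / r ^ Fintype.card ι)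
      (𝓝[>] 0) (𝓝 (volume.real A / (√(2 * Real.pi * v) ^ Fintype.card ι * |M.det|))) := by
  have hcont : Continuous fun z : ι → ℝ ↦ ∏ i, gaussianPDFReal 0 v (z i) := by
    unfold gaussianPDFReal
    fun_prop
  have hdet : LinearMap.det M.toLin' ≠ 0 := by rwa [LinearMap.det_toLin']
  have h := tendsto_withDensity_real_preimage_smul_div_pow (μ := (volume : Measure (ι → ℝ)))
    (fun z ↦ Finset.prod_nonneg fun i _ ↦ gaussianPDFReal_nonneg 0 v (z i))
    hcont.aestronglyMeasurable hcont.continuousAt hA hdet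
  have hpeak : ∏ i, gaussianPDFReal 0 v ((0 : ι → ℝ) i) =
      (√(2 * Real.pi * v) ^ Fintype.card ι)⁻¹ := by
    simp only [gaussianPDFReal, Pi.zero_apply, sub_self, zero_pow two_ne_zero, neg_zero, zero_div,
      Real.exp_zero, mul_one, Finset.prod_const, Finset.card_univ, inv_pow]
  rwa [← pi_gaussianReal_eq_withDensity hv, LinearMap.det_toLin', finrank_fintype_fun_eq_card,
    hpeak, inv_mul_eq_div, div_div, mul_comm |M.det|] at h

end Gaussian

section Polyball

/-- The product over `ι` of open Euclidean unit balls of `ℝ^K`, as a set of vectors with the flat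
index `ι × K`, so that matrices over `ι × K` act on it. -/
def unitPolyball (ι K : Type*) [Fintype K] : Set (ι × K → ℝ) :=
  {z | ∀ i, ∑ j, z (i, j) ^ 2 < 1}

variable {ι K : Type*} [Fintype K]

lemma mem_smul_unitPolyball {r : ℝ} (hr : 0 < r) {z : ι × K → ℝ} :
    z ∈ r • unitPolyball ι K ↔ ∀ i, ∑ j, z (i, j) ^ 2 < r ^ 2 := by
  rw [mem_smul_set_iff_inv_smul_mem₀ hr.ne']
  refine forall_congr' fun i ↦ ?_
  simp only [Pi.smul_apply, smul_eq_mul, mul_pow, ← Finset.mul_sum, inv_pow]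
  rw [inv_mul_lt_one₀ (by positivity)]

lemma isOpen_unitPolyball [Finite ι] : IsOpen (unitPolyball ι K) := by
  simp only [unitPolyball, ofPred_forall]
  exact isOpen_iInter_of_finite fun i ↦ isOpen_lt (by fun_prop) continuous_const

lemma isBounded_unitPolyball [Finite ι] : Bornology.IsBounded (unitPolyball ι K) := by
  have := Fintype.ofFinite ι
  refine Metric.isBounded_closedBall.subset fun z hz ↦
    mem_closedBall_zero_iff.2 ((pi_norm_le_iff_of_nonneg zero_le_one).2 fun p ↦ ?_)
  have hle : z p ^ 2 ≤ ∑ j, z (p.1, j) ^ 2 :=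
    Finset.single_le_sum (f := fun j ↦ z (p.1, j) ^ 2) (fun _ _ ↦ sq_nonneg _)
      (Finset.mem_univ p.2)
  exact (sq_le_one_iff_abs_le_one _).1 (hle.trans (hz p.1).le)

lemma volume_real_sum_sq_lt_one :
    volume.real {w : K → ℝ | ∑ j, w j ^ 2 < 1} =
      √Real.pi ^ Fintype.card K / Real.Gamma (Fintype.card K / 2 + 1) := by
  have hΓ : 2 * Real.Gamma (1 / 2 + 1) = √Real.pi := by
    rw [Real.Gamma_add_one one_half_pos.ne', Real.Gamma_one_half_eq]
    ring
  have h := volume_sum_rpow_lt_one K one_le_two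
  simp only [Real.rpow_two, sq_abs, hΓ] at h
  rw [Measure.real, h, ENNReal.toReal_ofReal (by positivity)]

variable [Fintype ι]

lemma volume_real_unitPolyball :
    volume.real (unitPolyball ι K) =
      (√Real.pi ^ Fintype.card K / Real.Gamma (Fintype.card K / 2 + 1)) ^ Fintype.card ι := by
  have hbox : (MeasurableEquiv.curry ι K ℝ).symm ⁻¹' unitPolyball ι K =
      univ.pi fun _ ↦ {w | ∑ j, w j ^ 2 < 1} := by
    ext z
    simp [unitPolyball, MeasurableEquiv.curry]
  have hvol := (measurePreserving_curry_symm
    fun (_ : ι) (_ : K) ↦ (volume : Measure ℝ)).measure_preimage_equiv (unitPolyball ι K)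
  rw [hbox, Measure.pi_pi, Finset.prod_const, Finset.card_univ] at hvol
  rw [← volume_real_sum_sq_lt_one, Measure.real, Measure.real, ← ENNReal.toReal_pow, volume_pi,
    ← hvol]
  rfl

lemma tendsto_pi_gaussianReal_real_smul_unitPolyball [DecidableEq ι] [DecidableEq K] {v : ℝ≥0}
    (hv : v ≠ 0) {M : Matrix (ι × K) (ι × K) ℝ} (hM : M.det ≠ 0) :
    Tendsto (fun r : ℝ ↦ (Measure.pi fun _ : ι × K ↦ gaussianReal 0 v).real
        ((M *ᵥ ·) ⁻¹' (r • unitPolyball ι K)) / r ^ (Fintype.card ι * Fintype.card K))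
      (𝓝[>] 0) (𝓝 ((√(2 * v) ^ Fintype.card K *
        Real.Gamma (Fintype.card K / 2 + 1)) ^ Fintype.card ι * |M.det|)⁻¹) := by
  have h := tendsto_pi_gaussianReal_real_preimage_smul_div_pow hv isBounded_unitPolyball hM
  rw [volume_real_unitPolyball, Fintype.card_prod] at h
  convert h using 2
  have hsqrt : √(2 * Real.pi * v) = √(2 * v) * √Real.pi := by
    rw [← Real.sqrt_mul (by positivity), mul_right_comm]
  rw [hsqrt, mul_pow, mul_comm (Fintype.card ι)]
  simp only [div_pow, mul_pow, pow_mul]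
  have := (Real.sqrt_pos.2 Real.pi_pos).ne'
  field_simp

end Polyball

section Mixing

lemma kronecker_one_mulVec_apply {ι κ R : Type*} [Fintype ι] [Fintype κ] [DecidableEq κ]
    [NonAssocSemiring R] (A : Matrix ι ι R) (z : ι × κ → R) (i : ι) (j : κ) :
    ((A ⊗ₖ (1 : Matrix κ κ R)) *ᵥ z) (i, j) = (A *ᵥ fun k ↦ z (k, j)) i := by
  simp [Matrix.mulVec, dotProduct, Fintype.sum_prod_type, Matrix.one_apply]

lemma kronecker_one_dotProduct_self {ι κ R : Type*} [Fintype ι] [Fintype κ] [DecidableEq κ]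
    [NonAssocSemiring R] (A : Matrix ι ι R) (p : ι × κ) :
    (A ⊗ₖ (1 : Matrix κ κ R)) p ⬝ᵥ (A ⊗ₖ (1 : Matrix κ κ R)) p = A p.1 ⬝ᵥ A p.1 := by
  simp [dotProduct, Fintype.sum_prod_type, Matrix.one_apply]

variable {N : ℕ} [NeZero N]

/-- The matrix taking one coordinate of the independent Gaussian samples, listed by port, to the
same coordinate of the gains: row `n ≠ 0` mixes port `n` with the reference port `0`. -/
noncomputable def mixingMatrix (ρ : Fin N → ℝ) : Matrix (Fin N) (Fin N) ℝ :=
  Matrix.of fun n ↦ if n = 0 then Pi.single 0 1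
    else √(1 - ρ n ^ 2) • Pi.single n 1 + ρ n • Pi.single 0 1

lemma mixingMatrix_zero (ρ : Fin N → ℝ) : mixingMatrix ρ 0 = Pi.single 0 1 :=
  funext fun _ ↦ by simp [mixingMatrix]

lemma mixingMatrix_of_ne_zero (ρ : Fin N → ℝ) {n : Fin N} (hn : n ≠ 0) :
    mixingMatrix ρ n = √(1 - ρ n ^ 2) • Pi.single n 1 + ρ n • Pi.single 0 1 :=
  if_neg hn

lemma mixingMatrix_zero_dotProduct (ρ w : Fin N → ℝ) : mixingMatrix ρ 0 ⬝ᵥ w = w 0 := by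
  rw [mixingMatrix_zero, single_one_dotProduct]

lemma mixingMatrix_dotProduct_of_ne_zero (ρ w : Fin N → ℝ) {n : Fin N} (hn : n ≠ 0) :
    mixingMatrix ρ n ⬝ᵥ w = √(1 - ρ n ^ 2) * w n + ρ n * w 0 := by
  simp only [mixingMatrix_of_ne_zero ρ hn, add_dotProduct, smul_dotProduct, single_one_dotProduct,
    smul_eq_mul]

lemma mixingMatrix_dotProduct_self {ρ : Fin N → ℝ} {n : Fin N} (hρ : n ≠ 0 → |ρ n| ≤ 1) :
    mixingMatrix ρ n ⬝ᵥ mixingMatrix ρ n = 1 := by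
  by_cases hn : n = 0
  · rw [hn, mixingMatrix_zero_dotProduct, mixingMatrix_zero, Pi.single_eq_same]
  · have hsq : √(1 - ρ n ^ 2) ^ 2 = 1 - ρ n ^ 2 :=
      Real.sq_sqrt (sub_nonneg.2 ((sq_le_one_iff_abs_le_one _).2 (hρ hn)))
    rw [mixingMatrix_dotProduct_of_ne_zero ρ _ hn, mixingMatrix_of_ne_zero ρ hn]
    simp only [Pi.add_apply, Pi.smul_apply, Pi.single_eq_same, Pi.single_eq_of_ne hn,
      Pi.single_eq_of_ne' hn, smul_eq_mul]
    linear_combination hsq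

lemma isLowerTriangular_mixingMatrix (ρ : Fin N → ℝ) : (mixingMatrix ρ).IsLowerTriangular := by
  intro n l (hnl : n < l)
  have hl : l ≠ 0 := fun h ↦ Fin.not_lt_zero n (h ▸ hnl)
  by_cases hn : n = 0
  · rw [hn, mixingMatrix_zero, Pi.single_eq_of_ne hl]
  · simp [mixingMatrix_of_ne_zero ρ hn, hl, hnl.ne']

lemma det_mixingMatrix (ρ : Fin N → ℝ) :
    (mixingMatrix ρ).det = ∏ n ∈ Finset.univ.erase 0, √(1 - ρ n ^ 2) := by
  rw [Matrix.det_of_isLowerTriangular _ (isLowerTriangular_mixingMatrix ρ),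
    ← Finset.mul_prod_erase _ _ (Finset.mem_univ 0), mixingMatrix_zero, Pi.single_eq_same, one_mul]
  refine Finset.prod_congr rfl fun n hn ↦ ?_
  have hn0 : n ≠ 0 := Finset.ne_of_mem_erase hn
  simp [mixingMatrix_of_ne_zero ρ hn0, hn0]

/-- The matrix taking the vector of all Gaussian samples to the vector of the real and imaginary
parts of all gains. -/
noncomputable def gainMatrix (m : ℕ) (ρ : Fin N → ℝ) :
    Matrix (Fin N × (Fin m ⊕ Fin m)) (Fin N × (Fin m ⊕ Fin m)) ℝ :=
  mixingMatrix ρ ⊗ₖ 1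

variable {m : ℕ}

lemma gainMatrix_mulVec_apply (ρ : Fin N → ℝ) (z : Fin N × (Fin m ⊕ Fin m) → ℝ) (n : Fin N)
    (j : Fin m ⊕ Fin m) :
    (gainMatrix m ρ *ᵥ z) (n, j) = mixingMatrix ρ n ⬝ᵥ fun l ↦ z (l, j) :=
  kronecker_one_mulVec_apply _ z n j

lemma gainMatrix_dotProduct_self {ρ : Fin N → ℝ} {n : Fin N} (hρ : n ≠ 0 → |ρ n| ≤ 1)
    (j : Fin m ⊕ Fin m) : gainMatrix m ρ (n, j) ⬝ᵥ gainMatrix m ρ (n, j) = 1 :=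
  (kronecker_one_dotProduct_self _ _).trans (mixingMatrix_dotProduct_self hρ)

lemma det_gainMatrix {ρ : Fin N → ℝ} (hρ : ∀ n, n ≠ 0 → |ρ n| ≤ 1) :
    (gainMatrix m ρ).det = ∏ n ∈ Finset.univ.erase 0, (1 - ρ n ^ 2) ^ m := by
  rw [gainMatrix, Matrix.det_kronecker, Matrix.det_one, one_pow, mul_one, det_mixingMatrix,
    ← Finset.prod_pow]
  refine Finset.prod_congr rfl fun n hn ↦ ?_
  have hn' : ρ n ^ 2 ≤ 1 := (sq_le_one_iff_abs_le_one _).2 (hρ n (Finset.ne_of_mem_erase hn))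
  rw [Fintype.card_sum, Fintype.card_fin, ← two_mul, pow_mul, Real.sq_sqrt (sub_nonneg.2 hn')]

end Mixing

section Channel

variable {Ω : Type*} {N m : ℕ}

/-- All real and imaginary Gaussian samples in one vector; `Sum.inl k` indexes the real and
`Sum.inr k` the imaginary part of the `k`-th sample. -/
def sampleVector (x y : Fin N → Fin m → Ω → ℝ) (ω : Ω) (p : Fin N × (Fin m ⊕ Fin m)) : ℝ :=
  Sum.elim (fun k ↦ x p.1 k ω) (fun k ↦ y p.1 k ω) p.2

lemma hasLaw_sampleVector [MeasurableSpace Ω] {μ : Measure Ω} {ν : Measure ℝ}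
    [IsProbabilityMeasure ν] {x y : Fin N → Fin m → Ω → ℝ}
    (hx : ∀ n k, HasLaw (x n k) ν μ) (hy : ∀ n k, HasLaw (y n k) ν μ)
    (hindep : iIndepFun
      (Sum.elim (fun p : Fin N × Fin m ↦ x p.1 p.2) (fun p : Fin N × Fin m ↦ y p.1 p.2)) μ) :
    HasLaw (sampleVector x y) (Measure.pi fun _ ↦ ν) μ := by
  have hlaw (p : Fin N × (Fin m ⊕ Fin m)) : HasLaw (fun ω ↦ sampleVector x y ω p) ν μ := by
    obtain ⟨n, k | k⟩ := p
    exacts [hx n k, hy n k]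
  have hindep' : iIndepFun (fun p ω ↦ sampleVector x y ω p) μ := by
    convert hindep.precomp (Equiv.prodSumDistrib (Fin N) (Fin m) (Fin m)).injective using 2 with p
    obtain ⟨n, k | k⟩ := p <;> rfl
  exact hindep'.hasLaw_pi hlaw

variable [NeZero N]

lemma norm_gain_sq (ρ : Fin N → ℝ) (x y : Fin N → Fin m → Ω → ℝ) (n : Fin N) (k : Fin m)
    (ω : Ω) :
    ‖gain ρ x y n k ω‖ ^ 2 =
      (mixingMatrix ρ n ⬝ᵥ fun l ↦ x l k ω) ^ 2 + (mixingMatrix ρ n ⬝ᵥ fun l ↦ y l k ω) ^ 2 := by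
  by_cases hn : n = 0
  · rw [hn, gain, if_pos rfl, mixingMatrix_zero_dotProduct, mixingMatrix_zero_dotProduct,
      ← Complex.normSq_eq_norm_sq, mul_comm, Complex.normSq_add_mul_I]
  · rw [gain, if_neg hn, mixingMatrix_dotProduct_of_ne_zero _ _ hn,
      mixingMatrix_dotProduct_of_ne_zero _ _ hn, ← Complex.normSq_eq_norm_sq, mul_comm Complex.I,
      Complex.normSq_add_mul_I]

lemma channel_eq_sum_sq (ρ : Fin N → ℝ) (x y : Fin N → Fin m → Ω → ℝ) (n : Fin N) (ω : Ω) :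
    channel ρ x y n ω = ∑ j, (gainMatrix m ρ *ᵥ sampleVector x y ω) (n, j) ^ 2 := by
  simp only [channel, norm_gain_sq, Fintype.sum_sum_type, Finset.sum_add_distrib,
    gainMatrix_mulVec_apply, sampleVector, Sum.elim_inl, Sum.elim_inr]

lemma selectedSNR_nonneg (ρ : Fin N → ℝ) (x y : Fin N → Fin m → Ω → ℝ) {s : ℝ} (hs : 0 ≤ s)
    (ω : Ω) : 0 ≤ selectedSNR ρ x y s ω := by
  refine le_trans ?_ (Finset.le_sup' (fun n ↦ portSNR ρ x y s n ω) (Finset.mem_univ 0))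
  unfold portSNR channel
  positivity

lemma natCast_mul_two_rpow_sub_one_pos (hm : 0 < m) {θ : ℝ} (hθ : 0 < θ) :
    0 < (m : ℝ) * (2 ^ θ - 1) :=
  mul_pos (Nat.cast_pos.2 hm) (sub_pos.2 (Real.one_lt_rpow one_lt_two hθ))

lemma logb_selectedSNR_lt_iff (hm : 0 < m) (ρ : Fin N → ℝ) (x y : Fin N → Fin m → Ω → ℝ)
    {θ s : ℝ} (hθ : 0 < θ) (hs : 0 < s) (ω : Ω) :
    Real.logb 2 (1 + selectedSNR ρ x y s ω) < θ ↔
      gainMatrix m ρ *ᵥ sampleVector x y ω ∈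
        √(m * (2 ^ θ - 1) / s) • unitPolyball (Fin N) (Fin m ⊕ Fin m) := by
  have hm' : (0 : ℝ) < m := Nat.cast_pos.2 hm
  have hlevel : 0 < m * (2 ^ θ - 1) / s := div_pos (natCast_mul_two_rpow_sub_one_pos hm hθ) hs
  have hpos : 0 < 1 + selectedSNR ρ x y s ω := by linarith [selectedSNR_nonneg ρ x y hs.le ω]
  rw [mem_smul_unitPolyball (Real.sqrt_pos.2 hlevel), Real.sq_sqrt hlevel.le,
    Real.logb_lt_iff_lt_rpow one_lt_two hpos, ← lt_sub_iff_add_lt', selectedSNR,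
    Finset.sup'_lt_iff]
  simp only [Finset.mem_univ, true_imp_iff, portSNR, channel_eq_sum_sq]
  refine forall_congr' fun n ↦ ?_
  rw [lt_div_iff₀ hs, div_mul_eq_mul_div, div_lt_iff₀ hm', mul_comm s, mul_comm _ (m : ℝ)]

lemma prod_one_sub_sq_pow_pos {ρ : Fin N → ℝ} (hρ : ∀ n, n ≠ 0 → |ρ n| < 1) (m : ℕ) :
    0 < ∏ n ∈ Finset.univ.erase 0, (1 - ρ n ^ 2) ^ m :=
  Finset.prod_pos fun n hn ↦
    pow_pos (sub_pos.2 ((sq_lt_one_iff_abs_lt_one _).2 (hρ n (Finset.ne_of_mem_erase hn)))) m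

lemma tendsto_pi_gaussianReal_real_gainMatrix_div_pow {ρ : Fin N → ℝ}
    (hρ : ∀ n, n ≠ 0 → |ρ n| < 1) :
    Tendsto (fun r : ℝ ↦ (Measure.pi fun _ ↦ gaussianReal 0 (1 / 2)).real
        ((gainMatrix m ρ *ᵥ ·) ⁻¹' (r • unitPolyball (Fin N) (Fin m ⊕ Fin m))) / r ^ (2 * (m * N)))
      (𝓝[>] 0)
      (𝓝 (Real.Gamma (m + 1) ^ N * ∏ n ∈ Finset.univ.erase 0, (1 - ρ n ^ 2) ^ m)⁻¹) := by
  have hprod := prod_one_sub_sq_pow_pos hρ m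
  have hdet := det_gainMatrix (m := m) fun n hn ↦ (hρ n hn).le
  have h := tendsto_pi_gaussianReal_real_smul_unitPolyball (v := 1 / 2) (by norm_num)
    (hdet ▸ hprod.ne')
  have hdim : N * (m + m) = 2 * (m * N) := by ring
  have hvar : √(2 * ((1 / 2 : ℝ≥0) : ℝ)) = 1 := by norm_num
  have hhalf : ((m + m : ℕ) : ℝ) / 2 = m := by
    push_cast
    ring
  rwa [hdet, abs_of_pos hprod, Fintype.card_sum, Fintype.card_fin, Fintype.card_fin, hdim, hvar,
    hhalf, one_pow, one_mul] at h

lemma outageGain_pos (hm : 0 < m) {ρ : Fin N → ℝ} (hρ : ∀ n, n ≠ 0 → |ρ n| < 1) {θ : ℝ}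
    (hθ : 0 < θ) : 0 < outageGain m ρ θ :=
  div_pos (pow_pos (natCast_mul_two_rpow_sub_one_pos hm hθ) _)
    (mul_pos (pow_pos (Real.Gamma_pos_of_pos (by positivity)) N) (prod_one_sub_sq_pow_pos hρ m))

section Law

variable [MeasurableSpace Ω] {μ : Measure Ω} {x y : Fin N → Fin m → Ω → ℝ}
  (hlaw : HasLaw (sampleVector x y) (Measure.pi fun _ ↦ gaussianReal 0 (1 / 2)) μ)
include hlaw

lemma integral_portSNR (hm : 0 < m) {ρ : Fin N → ℝ} {n : Fin N} (hρ : n ≠ 0 → |ρ n| ≤ 1) (s : ℝ) :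
    ∫ ω, portSNR ρ x y s n ω ∂μ = s := by
  have hmoment (j : Fin m ⊕ Fin m) :
      ∫ z, (gainMatrix m ρ *ᵥ z) (n, j) ^ 2 ∂Measure.pi (fun _ ↦ gaussianReal 0 (1 / 2)) =
        1 / 2 := by
    refine (integral_dotProduct_sq_pi_gaussianReal _ _).trans ?_
    rw [gainMatrix_dotProduct_self hρ]
    norm_num
  have hint (j : Fin m ⊕ Fin m) : Integrable (fun z ↦ (gainMatrix m ρ *ᵥ z) (n, j) ^ 2)
      (Measure.pi fun _ ↦ gaussianReal 0 (1 / 2)) :=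
    integrable_dotProduct_sq_pi_gaussianReal _ _
  have hchannel : ∫ ω, channel ρ x y n ω ∂μ = m := by
    simp only [channel_eq_sum_sq]
    have hmeas : Continuous fun z ↦ ∑ j, (gainMatrix m ρ *ᵥ z) (n, j) ^ 2 := by fun_prop
    refine (hlaw.integral_comp hmeas.aestronglyMeasurable).trans ?_
    rw [integral_finsetSum _ fun j _ ↦ hint j]
    simp only [hmoment, Finset.sum_const, Finset.card_univ, Fintype.card_sum, Fintype.card_fin,
      nsmul_eq_mul]
    push_cast
    ring
  have hm' : (m : ℝ) ≠ 0 := Nat.cast_ne_zero.2 hm.ne'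
  simp only [portSNR]
  rw [integral_const_mul, hchannel, div_mul_cancel₀ _ hm']

lemma outageProbability_eq_pi_gaussianReal_real (hm : 0 < m) (ρ : Fin N → ℝ) {θ s : ℝ}
    (hθ : 0 < θ) (hs : 0 < s) :
    outageProbability μ ρ x y θ s = (Measure.pi fun _ ↦ gaussianReal 0 (1 / 2)).real
      ((gainMatrix m ρ *ᵥ ·) ⁻¹'
        (√(m * (2 ^ θ - 1) / s) • unitPolyball (Fin N) (Fin m ⊕ Fin m))) := by
  have hlevel : 0 < m * (2 ^ θ - 1) / s := div_pos (natCast_mul_two_rpow_sub_one_pos hm hθ) hs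
  simp only [outageProbability, logb_selectedSNR_lt_iff hm ρ x y hθ hs]
  have hopen : IsOpen ((gainMatrix m ρ *ᵥ ·) ⁻¹'
      (√(m * (2 ^ θ - 1) / s) • unitPolyball (Fin N) (Fin m ⊕ Fin m))) :=
    (isOpen_unitPolyball.smul₀ (Real.sqrt_pos.2 hlevel).ne').preimage (by fun_prop)
  exact hlaw.measureReal_eq (p := (gainMatrix m ρ *ᵥ · ∈ _)) hopen.measurableSet

lemma hasOutageGain_outageProbability (hm : 0 < m) {ρ : Fin N → ℝ}
    (hρ : ∀ n, n ≠ 0 → |ρ n| < 1) {θ : ℝ} (hθ : 0 < θ) :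
    HasOutageGain (outageProbability μ ρ x y θ) (m * N) (outageGain m ρ θ) := by
  set a : ℝ := m * (2 ^ θ - 1) with ha_def
  have ha : 0 < a := natCast_mul_two_rpow_sub_one_pos hm hθ
  have hradius : Tendsto (fun s : ℝ ↦ √(a / s)) atTop (𝓝[>] 0) := by
    refine tendsto_nhdsWithin_iff.2 ⟨?_, ?_⟩
    · simpa using (tendsto_const_nhds.div_atTop tendsto_id).sqrt
    · filter_upwards [eventually_gt_atTop 0] with s hs
      exact Real.sqrt_pos.2 (div_pos ha hs)
  have hlim := ((tendsto_pi_gaussianReal_real_gainMatrix_div_pow (m := m) hρ).comp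
    hradius).const_mul (a ^ (m * N))
  rw [← div_eq_mul_inv] at hlim
  refine hlim.congr' ?_
  filter_upwards [eventually_gt_atTop 0] with s hs
  rw [outageProbability_eq_pi_gaussianReal_real hlaw hm ρ hθ hs, ← ha_def, Function.comp_apply,
    pow_mul √(a / s), Real.sq_sqrt (div_pos ha hs).le, div_pow]
  field_simp

end Law

end Channel

section Asymptotics

variable {P : ℝ → ℝ} {d : ℕ} {G : ℝ}

lemma HasOutageGain.isEquivalent (h : HasOutageGain P d G) (hG : G ≠ 0) :
    P ~[atTop] fun s ↦ G / s ^ d := by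
  have hone := h.div_const G
  rw [div_self hG] at hone
  refine isEquivalent_of_tendsto_one (hone.congr fun s ↦ ?_)
  rw [Pi.div_apply, div_div_eq_mul_div]

lemma HasOutageGain.hasDiversityOrder (h : HasOutageGain P d G) (hG : G ≠ 0) :
    HasDiversityOrder P d := by
  have hlog : Tendsto (fun s ↦ Real.log (P s * s ^ d)) atTop (𝓝 (Real.log G)) :=
    (Real.continuousAt_log hG).tendsto.comp h
  have hquot := (hlog.div_atTop Real.tendsto_log_atTop).const_sub (d : ℝ)
  rw [sub_zero] at hquot
  refine hquot.congr' ?_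
  filter_upwards [eventually_gt_atTop 1, h.eventually_ne hG] with s hs hP
  have hlog_ne : Real.log s ≠ 0 := (Real.log_pos hs).ne'
  rw [Real.log_mul (left_ne_zero_of_mul hP) (right_ne_zero_of_mul hP), Real.log_pow]
  field_simp
  ring

lemma outageGain_div_pow {N : ℕ} [NeZero N] (m : ℕ) (ρ : Fin N → ℝ) (θ s : ℝ) :
    outageGain m ρ θ / s ^ (m * N) =
      (m / s * (2 ^ θ - 1)) ^ (m * N) * (Real.Gamma (m + 1) ^ (-(N : ℤ)) /
        ∏ n ∈ Finset.univ.erase 0, (1 - ρ n ^ 2) ^ m) := by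
  rw [outageGain, zpow_neg, zpow_natCast, div_mul_eq_mul_div, div_pow, div_mul_div_comm,
    ← div_eq_mul_inv, div_div, div_div, mul_left_comm, mul_comm (s ^ _)]

end Asymptotics

section Topology

lemma exists_abs_cos_mul_sin_lt_one {z : ℝ} (hz : z ≠ 0) :
    ∃ t ∈ Icc 0 Real.pi, |Real.cos (z * Real.sin t)| < 1 := by
  have hpi : 1 < Real.pi := by linarith [Real.pi_gt_three]
  obtain ⟨t, ht, htz⟩ : ∃ t ∈ Ioo 0 Real.pi, |z| * t < Real.pi := by
    refine ⟨min 1 |z|⁻¹, ⟨by positivity, (min_le_left _ _).trans_lt hpi⟩, ?_⟩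
    calc |z| * min 1 |z|⁻¹ ≤ |z| * |z|⁻¹ :=
          mul_le_mul_of_nonneg_left (min_le_right _ _) (abs_nonneg z)
      _ = 1 := mul_inv_cancel₀ (abs_ne_zero.2 hz)
      _ < Real.pi := hpi
  have hsin : 0 < Real.sin t := Real.sin_pos_of_mem_Ioo ht
  have harg : |z| * Real.sin t < Real.pi :=
    (mul_le_mul_of_nonneg_left (Real.sin_lt ht.1).le (abs_nonneg z)).trans_lt htz
  refine ⟨t, Ioo_subset_Icc_self ht, (sq_lt_one_iff_abs_lt_one _).1 ?_⟩
  rw [← Real.cos_abs, abs_mul, abs_of_pos hsin, Real.cos_sq']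
  exact sub_lt_self 1 (pow_pos (Real.sin_pos_of_pos_of_lt_pi (by positivity) harg) 2)

lemma abs_besselJ0_lt_one {z : ℝ} (hz : z ≠ 0) : |besselJ0 z| < 1 := by
  have hcont : Continuous fun t ↦ Real.cos (z * Real.sin t) := by fun_prop
  have hint : |∫ t in (0 : ℝ)..Real.pi, Real.cos (z * Real.sin t)| < Real.pi :=
    calc |∫ t in (0 : ℝ)..Real.pi, Real.cos (z * Real.sin t)|
        ≤ ∫ t in (0 : ℝ)..Real.pi, |Real.cos (z * Real.sin t)| :=
          intervalIntegral.abs_integral_le_integral_abs Real.pi_pos.le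
      _ < ∫ _t in (0 : ℝ)..Real.pi, (1 : ℝ) :=
          intervalIntegral.integral_lt_integral_of_continuousOn_of_le_of_exists_lt Real.pi_pos
            hcont.abs.continuousOn continuousOn_const (fun t _ ↦ Real.abs_cos_le_one _)
            (exists_abs_cos_mul_sin_lt_one hz)
      _ = Real.pi := by rw [integral_one, sub_zero]
  rwa [besselJ0, one_div_mul_eq_div, abs_div, abs_of_pos Real.pi_pos, div_lt_one Real.pi_pos]

lemma abs_spatialCorrelation_lt_one {N : ℕ} {d : Fin N → ℝ} {lam : ℝ} (hlam : lam ≠ 0) {n : Fin N}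
    (hd : d n ≠ 0) : |spatialCorrelation d lam n| < 1 :=
  abs_besselJ0_lt_one (mul_ne_zero Real.two_pi_pos.ne' (div_ne_zero hd hlam))

lemma displacement_pos {N : ℕ} [NeZero N] (a : Architecture) {W lam : ℝ} (hW : 0 < W)
    (hlam : 0 < lam) {n : Fin N} (hn : n ≠ 0) : 0 < displacement a W lam n := by
  have hn_pos : 0 < (n : ℕ) := Fin.pos_iff_ne_zero.2 hn
  have hn_cast : (1 : ℝ) ≤ (n : ℕ) := Nat.one_le_cast.2 hn_pos
  have hnN : ((n : ℕ) : ℝ) < N := Nat.cast_lt.2 n.2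
  have hsize : 0 < W * lam := mul_pos hW hlam
  cases a with
  | linear => exact mul_pos (div_pos (by linarith) (by linarith)) hsize
  | circular =>
    have hfrac : 0 < ((n : ℕ) : ℝ) / N := div_pos (by linarith) (by linarith)
    refine mul_pos (Real.sin_pos_of_pos_of_lt_pi (mul_pos hfrac Real.pi_pos) ?_) hsize
    exact mul_lt_of_lt_one_left Real.pi_pos ((div_lt_one (by linarith)).2 hnN)
  | wheel =>
    rw [displacement, if_pos hn_pos]
    exact half_pos hsize

end Topology

end FluidAntenna

theorem corollary1 {Ω : Type*} [MeasurableSpace Ω] (μ : Measure Ω) [IsProbabilityMeasure μ]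
    {N m : ℕ} [NeZero N] (hm : 1 ≤ m)
    (x y : Fin N → Fin m → Ω → ℝ)
    (hx : ∀ n k, HasLaw (x n k) (gaussianReal 0 (1 / 2)) μ)
    (hy : ∀ n k, HasLaw (y n k) (gaussianReal 0 (1 / 2)) μ)
    (hindep : iIndepFun
      (Sum.elim (fun p : Fin N × Fin m => x p.1 p.2) (fun p : Fin N × Fin m => y p.1 p.2)) μ)
    (θ : ℝ) (hθ : 0 < θ) :
    -- arbitrary correlation coefficients
    (∀ ρ : Fin N → ℝ, (∀ n, n ≠ 0 → |ρ n| < 1) →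
      -- `s` is the average SNR at every port
      (∀ (s : ℝ) (n : Fin N), ∫ ω, portSNR ρ x y s n ω ∂μ = s) ∧
      (outageProbability μ ρ x y θ) ~[atTop]
        (fun s : ℝ => ((m : ℝ) / s * ((2 : ℝ) ^ θ - 1)) ^ (m * N)
          * (Real.Gamma ((m : ℝ) + 1) ^ (-(N : ℤ))
            / ∏ n ∈ Finset.univ.erase (0 : Fin N), (1 - ρ n ^ 2) ^ m)) ∧
      HasDiversityOrder (outageProbability μ ρ x y θ) ((m : ℝ) * (N : ℝ)) ∧
      0 < outageGain m ρ θ ∧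
      HasOutageGain (outageProbability μ ρ x y θ) (m * N) (outageGain m ρ θ)) ∧
    -- any topology, given by the displacements of the ports from the first one
    (∀ (lam : ℝ) (d : Fin N → ℝ), 0 < lam → (∀ n, n ≠ 0 → 0 < d n) →
      (∀ n, n ≠ 0 → |spatialCorrelation d lam n| < 1) ∧
      HasDiversityOrder (outageProbability μ (spatialCorrelation d lam) x y θ)
        ((m : ℝ) * (N : ℝ)) ∧
      HasOutageGain (outageProbability μ (spatialCorrelation d lam) x y θ) (m * N)
        (outageGain m (spatialCorrelation d lam) θ)) ∧
    -- the linear, circular and wheel-shaped topologies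
    (∀ (a : Architecture) (W lam : ℝ), 0 < W → 0 < lam →
      (∀ n : Fin N, n ≠ 0 → 0 < displacement a W lam n) ∧
      HasDiversityOrder
        (outageProbability μ (spatialCorrelation (displacement a W lam) lam) x y θ)
        ((m : ℝ) * (N : ℝ)) ∧
      HasOutageGain
        (outageProbability μ (spatialCorrelation (displacement a W lam) lam) x y θ) (m * N)
        (outageGain (N := N) m (spatialCorrelation (displacement a W lam) lam) θ)) := by
  have hlaw := hasLaw_sampleVector hx hy hindep
  have hmain (ρ : Fin N → ℝ) (hρ : ∀ n, n ≠ 0 → |ρ n| < 1) :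
      HasDiversityOrder (outageProbability μ ρ x y θ) ((m : ℝ) * (N : ℝ)) ∧
      HasOutageGain (outageProbability μ ρ x y θ) (m * N) (outageGain m ρ θ) := by
    have hgain := hasOutageGain_outageProbability hlaw hm hρ hθ
    exact ⟨Nat.cast_mul (α := ℝ) m N ▸ hgain.hasDiversityOrder (outageGain_pos hm hρ hθ).ne',
      hgain⟩
  have hcorr {lam : ℝ} {d : Fin N → ℝ} (hlam : 0 < lam) (hd : ∀ n, n ≠ 0 → 0 < d n) (n : Fin N)
      (hn : n ≠ 0) : |spatialCorrelation d lam n| < 1 :=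
    abs_spatialCorrelation_lt_one hlam.ne' (hd n hn).ne'
  refine ⟨fun ρ hρ ↦ ⟨fun s n ↦ integral_portSNR hlaw hm (fun hn ↦ (hρ n hn).le) s, ?_,
    (hmain ρ hρ).1, outageGain_pos hm hρ hθ, (hmain ρ hρ).2⟩,
    fun lam d hlam hd ↦ ⟨hcorr hlam hd, hmain _ (hcorr hlam hd)⟩, fun a W lam hW hlam ↦ ?_⟩
  · simp only [← outageGain_div_pow]
    exact (hmain ρ hρ).2.isEquivalent (outageGain_pos hm hρ hθ).ne'
  · have hd (n : Fin N) (hn : n ≠ 0) : 0 < displacement a W lam n := displacement_pos a hW hlam hn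
    exact ⟨hd, hmain _ (hcorr hlam hd)⟩
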